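/- Let $G$ be a group that is amenable, meaning that there is a net $(F_j)_{j\in J}$ of nonempty finite subsets of $G$ with $\lim_j |gF_j\setminus F_j|/|F_j|=0$ for all $g\in G$. Let $X$ be a compact Hausdorff space on which $G$ acts so that $x\mapsto gx$ is continuous for every $g\in G$; "entourage" refers to the unique uniform structure inducing the topology of $X$. Suppose that (1) (expansiveness) there is an entourage $U_0$ such that no pair $x\neq y$ in $X$ satisfies $(gx,gy)\in U_0$ for all $g\in G$; (2) (weak specification) for every entourage $U$ there is a finite subset $\Lambda\subset G$ such that, for every finite sequence $\Omega_1,\dots,\Omega_n$ $(n\ge 1)$ of finite subsets of $G$ with $\Omega_j\cap\Lambda\Omega_k=\varnothing$ for all distinct $j,k$, and all points $x_1,\dots,x_n\in X$, there is $x\in X$ with $(gx,gx_i)\in U$ for all $1\le i\le n$ and $g\in\Omega_i$. Call $x,y\in X$ homoclinic if for every entourage $U$ there is a finite subset $\Omega\subset G$ with $(gx,gy)\in U$ for all $g\in G\setminus\Omega$; this is an equivalence relation. An endomorphism of $(X,G)$ is a continuous map $f\colon X\to X$ with $f(gx)=gf(x)$ for all $g\in G$, $x\in X$; it is pre-injective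 if its restriction to each homoclinicity class is injective. Then $(X,G)$ has the Myhill property: every pre-injective endomorphism of $(X,G)$ is surjective. In particular, $(X,G)$ is surjunctive: every injective endomorphism of $(X,G)$ is surjective. -/

import Mathlib

open Filter Topology Uniformity
open scoped Pointwise

namespace UniformDynamics

universe u v

/-- A (discrete) group `G` is amenable if it has a left Følner net: a net `(F j)` of nonempty
finite subsets of `G`, indexed by a directed set `J`, with `|g F j \ F j| / |F j| → 0` for every
`g : G`. Index sets in the universe of `G` suffice, since a Følner net in any universe yields one
indexed by `Finset G × ℕ`. -/
def IsAmenable (G : Type u) [Group G] : Prop :=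
  ∃ (J : Type u) (_ : Preorder J) (_ : IsDirectedOrder J) (_ : Nonempty J) (F : J → Finset G),
    (∀ j, (F j).Nonempty) ∧
    ∀ g : G, Tendsto
      (fun j => (((g • (F j : Set G)) \ (F j : Set G)).ncard : ℝ) / ((F j).card : ℝ))
      atTop (𝓝 0)

section

variable (G : Type u) (X : Type v) [Group G] [UniformSpace X] [MulAction G X]

/-- Expansiveness: some entourage `U₀` contains no pair of distinct points together with its whole
`G`-orbit. -/
def IsExpansive : Prop :=
  ∃ U₀ ∈ 𝓤 X, ∀ x y : X, (∀ g : G, (g • x, g • y) ∈ U₀) → x = y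

/-- The weak specification property, for finite sequences `Ω₁, …, Ωₙ` with `n ≥ 1`. -/
def HasWeakSpecification : Prop :=
  ∀ U ∈ 𝓤 X, ∃ Λ : Finset G,
    ∀ (n : ℕ), 1 ≤ n → ∀ (Ω : Fin n → Finset G),
      (∀ j k : Fin n, j ≠ k → (Ω j : Set G) ∩ ((Λ : Set G) * (Ω k : Set G)) = ∅) →
      ∀ p : Fin n → X, ∃ x : X, ∀ i : Fin n, ∀ g ∈ Ω i, (g • x, g • p i) ∈ U

variable {X}

/-- Two points are homoclinic if for every entourage `U` there is a finite `Ω ⊆ G` such that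
`(g x, g y) ∈ U` for all `g ∉ Ω`. -/
def Homoclinic (x y : X) : Prop :=
  ∀ U ∈ 𝓤 X, ∃ Ω : Finset G, ∀ g : G, g ∉ Ω → (g • x, g • y) ∈ U

/-- An endomorphism of `(X, G)`: a continuous `G`-equivariant self-map. -/
def IsEndomorphism (f : X → X) : Prop :=
  Continuous f ∧ ∀ (g : G) (x : X), f (g • x) = g • f x

/-- A map is pre-injective if its restriction to each homoclinicity class is injective. -/
def IsPreInjective (f : X → X) : Prop :=
  ∀ x : X, Set.InjOn f {y : X | Homoclinic G x y}

variable (X)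

/-- The Myhill property: every pre-injective endomorphism is surjective. -/
def HasMyhillProperty : Prop :=
  ∀ f : X → X, IsEndomorphism G f → IsPreInjective G f → Function.Surjective f

/-- Surjunctivity: every injective endomorphism is surjective. -/
def IsSurjunctive : Prop :=
  ∀ f : X → X, IsEndomorphism G f → Function.Injective f → Function.Surjective f

end

end UniformDynamics

namespace UniformDynamics

universe u v w

/-! This is a Garden of Eden counting argument on a single finite set F, with no entropy limit.
Suppose f misses x₀, and let S be a (U, F)-separated set of maximal size.

Specification glues each point of S along F to one reference point off ΛF. Expansiveness makes the
glued points homoclinic, so f is injective on them, and it separates their images along ΛF. Cutting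
down to F loses at most a factor C^|ΛF \ F| (`IsPreInjective.exists_isSep_image`).

The range of f is invariant and stays away from x₀, so inserting x₀ into its orbits at arbitrary
subsets of a Λ-separated T ⊆ F gains a factor (1 + C^(-|Λ|))^|T|
(`IsSpecWitness.exists_isSep_of_avoiding`). Since |T| ≥ |F|/|Λ|, a Følner set F with small boundary
makes the gain exceed the loss, against maximality. -/

/-! ### Separated nets, entourages and finite codes -/

theorem exists_separated_net {α : Type*} (S : Finset α) (R : α → α → Prop)
    (hrefl : ∀ x, R x x) (hsymm : ∀ x y, R x y → R y x) :
    ∃ S' ⊆ S, (∀ x ∈ S', ∀ y ∈ S', R x y → x = y) ∧ ∀ x ∈ S, ∃ y ∈ S', R x y := by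
  classical
  induction S using Finset.induction_on with
  | empty => exact ⟨∅, by simp⟩
  | insert a S _ ih =>
    obtain ⟨S', hS, hsep, hnet⟩ := ih
    by_cases h : ∃ y ∈ S', R a y
    · refine ⟨S', hS.trans (Finset.subset_insert _ _), hsep, fun x hx => ?_⟩
      rcases Finset.mem_insert.1 hx with rfl | hx
      · exact h
      · exact hnet x hx
    · push Not at h
      refine ⟨insert a S', Finset.insert_subset_insert _ hS, ?_, fun x hx => ?_⟩
      · intro x hx y hy hxy
        rcases Finset.mem_insert.1 hx with rfl | hx' <;>
          rcases Finset.mem_insert.1 hy with rfl | hy'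
        · rfl
        · exact absurd hxy (h y hy')
        · exact absurd (hsymm _ _ hxy) (h _ hx')
        · exact hsep x hx' y hy' hxy
      · rcases Finset.mem_insert.1 hx with rfl | hx
        · exact ⟨x, Finset.mem_insert_self _ _, hrefl x⟩
        · obtain ⟨y, hy, hxy⟩ := hnet x hx
          exact ⟨y, Finset.mem_insert_of_mem hy, hxy⟩

theorem exists_separated_net_card {α : Type*} (S : Finset α) (R : α → α → Prop)
    (hrefl : ∀ x, R x x) (hsymm : ∀ x y, R x y → R y x) (n : ℕ)
    (hn : ∀ y ∈ S, ∀ P ⊆ S, (∀ x ∈ P, R x y) → P.card ≤ n) :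
    ∃ S' ⊆ S, (∀ x ∈ S', ∀ y ∈ S', R x y → x = y) ∧ S.card ≤ n * S'.card := by
  classical
  obtain ⟨S', hS, hsep, hnet⟩ := exists_separated_net S R hrefl hsymm
  refine ⟨S', hS, hsep, ?_⟩
  have hsub : S ⊆ S'.biUnion fun y => S.filter fun x => R x y := fun x hx => by
    obtain ⟨y, hy, hxy⟩ := hnet x hx
    exact Finset.mem_biUnion.2 ⟨y, hy, Finset.mem_filter.2 ⟨hx, hxy⟩⟩
  refine (Finset.card_le_card hsub).trans ?_
  rw [mul_comm]
  exact Finset.card_biUnion_le_card_mul _ _ _ fun y hy =>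
    hn y (hS hy) _ (Finset.filter_subset _ _) fun x hx => (Finset.mem_filter.1 hx).2

/-- A finite subset of `F` with no two distinct elements in the same left `Λ`-neighbourhood. -/
theorem exists_separated_subset {G : Type u} [Group G] (Λ F : Finset G)
    (hone : (1 : G) ∈ Λ) (hinv : ∀ g ∈ Λ, g⁻¹ ∈ Λ) :
    ∃ T ⊆ F, (∀ s ∈ T, ∀ t ∈ T, s * t⁻¹ ∈ Λ → s = t) ∧ F.card ≤ Λ.card * T.card := by
  refine exists_separated_net_card F (fun s t => s * t⁻¹ ∈ Λ) (fun x => by simpa using hone)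
    (fun x y h => by simpa using hinv _ h) _ fun y _ P _ hP => ?_
  exact Finset.card_le_card_of_injOn (fun x => x * y⁻¹) hP fun a _ b _ hab => by simpa using hab

theorem exists_entourage {X : Type v} [UniformSpace X] {V : Set (X × X)} (hV : V ∈ 𝓤 X) :
    ∃ U ∈ 𝓤 X, IsClosed U ∧ (∀ a b, (a, b) ∈ U → (b, a) ∈ U) ∧
      ∀ a b c d, (a, b) ∈ U → (b, c) ∈ U → (c, d) ∈ U → (a, d) ∈ V := by
  obtain ⟨W, hW, -, hWW⟩ := comp_symm_of_uniformity hV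
  obtain ⟨W', hW', -, hWW'⟩ := comp_symm_of_uniformity hW
  obtain ⟨U, hU, hcl, hUW⟩ := mem_uniformity_isClosed hW'
  refine ⟨U ∩ Prod.swap ⁻¹' U, Filter.inter_mem hU (tendsto_swap_uniformity hU),
    hcl.inter (hcl.preimage continuous_swap), fun a b h => ⟨h.2, h.1⟩, ?_⟩
  intro a b c d hab hbc hcd
  exact hWW ⟨c, hWW' ⟨b, hUW hab.1, hUW hbc.1⟩, hWW' ⟨c, refl_mem_uniformity hW', hUW hcd.1⟩⟩

theorem exists_code {X : Type v} [UniformSpace X] [CompactSpace X] {V : Set (X × X)}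
    (hV : V ∈ 𝓤 X) : ∃ (C : ℕ) (c : X → Fin C), ∀ x y, c x = c y → (x, y) ∈ V := by
  obtain ⟨U, hU, -, hsymm, hcomp⟩ := exists_entourage hV
  obtain ⟨t, ht, hcov⟩ := (isCompact_univ (X := X)).totallyBounded U hU
  have hex : ∀ x : X, ∃ y : t, (x, (y : X)) ∈ U := fun x => by
    obtain ⟨y, hy, hxy⟩ := Set.mem_iUnion₂.1 (hcov (Set.mem_univ x))
    exact ⟨⟨y, hy⟩, hxy⟩
  choose b hb using hex
  have := ht.fintype
  refine ⟨Fintype.card t, fun x => Fintype.equivFin t (b x), fun x y hxy => ?_⟩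
  have hbb : b x = b y := (Fintype.equivFin t).injective hxy
  exact hcomp x (b x) y y (hb x) (hbb ▸ hsymm _ _ (hb y)) (refl_mem_uniformity hU)

/-! ### Sets separated along a finite subset of the group -/

section

variable {G : Type u} {X : Type v} [Group G] [MulAction G X]

/-- Points of `S` that are `W`-close along all of `F` coincide. -/
def IsSep (W : Set (X × X)) (F : Finset G) (S : Finset X) : Prop :=
  ∀ x ∈ S, ∀ y ∈ S, (∀ g ∈ F, (g • x, g • y) ∈ W) → x = y

/-- Only times in F \ F₁ can tell points of S apart, so recording the codes at those times is
injective. -/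
theorem IsSep.card_le_of_close [DecidableEq G] {W : Set (X × X)} {F F₁ : Finset G} {S : Finset X}
    (hS : IsSep W F S) {C : ℕ} (c : X → Fin C) (hc : ∀ x y, c x = c y → (x, y) ∈ W)
    (hclose : ∀ x ∈ S, ∀ y ∈ S, ∀ g ∈ F₁, (g • x, g • y) ∈ W) :
    S.card ≤ C ^ (F \ F₁).card := by
  have h : S.card ≤ (Finset.univ : Finset ((F \ F₁ : Finset G) → Fin C)).card := by
    refine Finset.card_le_card_of_injOn (fun x g => c ((g : G) • x)) (fun _ _ => by simp) ?_
    intro x hx y hy hxy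
    refine hS x hx y hy fun g hg => ?_
    by_cases hg₁ : g ∈ F₁
    · exact hclose x hx y hy g hg₁
    · exact hc _ _ (congrFun hxy ⟨g, Finset.mem_sdiff.2 ⟨hg, hg₁⟩⟩)
  simpa using h

theorem IsSep.card_le [DecidableEq G] {W : Set (X × X)} {F : Finset G} {S : Finset X}
    (hS : IsSep W F S) {C : ℕ} (c : X → Fin C) (hc : ∀ x y, c x = c y → (x, y) ∈ W) :
    S.card ≤ C ^ F.card := by
  simpa using hS.card_le_of_close (F₁ := ∅) c hc (by simp)

/-- Take a W'-separated net along F₁: points clustered around one net point are W-close along F₁, so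
`IsSep.card_le_of_close` bounds each cluster. -/
theorem IsSep.exists_restrict [DecidableEq G] {W W' : Set (X × X)} {F F₁ : Finset G} {S : Finset X}
    (hS : IsSep W F S) {C : ℕ} (c : X → Fin C) (hc : ∀ x y, c x = c y → (x, y) ∈ W)
    (hrefl : ∀ x, (x, x) ∈ W') (hsymm : ∀ x y, (x, y) ∈ W' → (y, x) ∈ W')
    (hcomp : ∀ x y z, (x, y) ∈ W' → (y, z) ∈ W' → (x, z) ∈ W) :
    ∃ S' ⊆ S, IsSep W' F₁ S' ∧ S.card ≤ C ^ (F \ F₁).card * S'.card := by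
  refine exists_separated_net_card S (fun x y => ∀ g ∈ F₁, (g • x, g • y) ∈ W')
    (fun x g _ => hrefl _) (fun x y h g hg => hsymm _ _ (h g hg)) _ fun y _ P hP hPy => ?_
  have hsep : IsSep W F P := fun a ha b hb => hS a (hP ha) b (hP hb)
  exact hsep.card_le_of_close c hc fun a ha b hb g hg =>
    hcomp _ _ _ (hPy a ha g hg) (hsymm _ _ (hPy b hb g hg))

/-! ### Specification and gluing -/

/-- `Λ` witnesses the weak specification property for `U`. -/
def IsSpecWitness (U : Set (X × X)) (Λ : Finset G) : Prop :=
  ∀ (ι : Type u) [Finite ι] [Nonempty ι] (Ω : ι → Finset G),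
    (∀ j k, j ≠ k → ∀ a ∈ Ω j, ∀ b ∈ Ω k, a * b⁻¹ ∉ Λ) →
    ∀ p : ι → X, ∃ x : X, ∀ i, ∀ g ∈ Ω i, (g • x, g • p i) ∈ U

theorem HasWeakSpecification.exists_witness [UniformSpace X] (h : HasWeakSpecification G X)
    {U : Set (X × X)} (hU : U ∈ 𝓤 X) :
    ∃ Λ : Finset G, (1 : G) ∈ Λ ∧ (∀ g ∈ Λ, g⁻¹ ∈ Λ) ∧ IsSpecWitness U Λ := by
  classical
  obtain ⟨Λ, hΛ⟩ := h U hU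
  refine ⟨insert 1 (Λ ∪ Λ⁻¹), by simp, ?_, ?_⟩
  · intro g hg
    simp only [Finset.mem_insert, Finset.mem_union, Finset.mem_inv', inv_inv, inv_eq_one] at hg ⊢
    tauto
  · intro ι _ _ Ω hΩ p
    have := Fintype.ofFinite ι
    let e := Fintype.equivFin ι
    obtain ⟨x, hx⟩ := hΛ (Fintype.card ι) Fintype.card_pos (fun i => Ω (e.symm i)) (by
      intro j k hjk
      refine Set.eq_empty_iff_forall_notMem.2 ?_
      rintro _ ⟨ha, l, hl, b, hb, rfl⟩
      refine hΩ _ _ (e.symm.injective.ne hjk) _ ha b hb ?_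
      have hl' : l ∈ Λ := hl
      simp [hl']) (fun i => p (e.symm i))
    exact ⟨x, fun i g hg => by simpa using hx (e i) g (by simpa using hg)⟩

variable [UniformSpace X] [CompactSpace X] [ContinuousConstSMul G X]

/-- Gluing of a pattern on a finite set with a pattern on a cofinite set. -/
theorem IsSpecWitness.exists_glue [DecidableEq G] {U : Set (X × X)} {Λ : Finset G}
    (h : IsSpecWitness U Λ) (hcl : IsClosed U) (hinv : ∀ g ∈ Λ, g⁻¹ ∈ Λ) (F : Finset G)
    (x y : X) :
    ∃ z : X, (∀ g ∈ F, (g • z, g • x) ∈ U) ∧ ∀ g ∉ Λ * F, (g • z, g • y) ∈ U := by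
  have hclosed : ∀ (g : G) (p : X), IsClosed {z : X | (g • z, p) ∈ U} := fun g p =>
    hcl.preimage ((continuous_const_smul g).prodMk continuous_const)
  let A : G → Set X := fun g =>
    {z | (g ∈ F → (g • z, g • x) ∈ U) ∧ (g ∉ Λ * F → (g • z, g • y) ∈ U)}
  have himp : ∀ (P : Prop) (g : G) (p : X), IsClosed {z : X | P → (g • z, p) ∈ U} :=
    fun P g p => by
      by_cases hP : P
      · simpa only [hP, true_imp_iff] using hclosed g p
      · simp [hP]
  have hA : ∀ g, IsClosed (A g) := fun g => (himp _ g _).inter (himp _ g _)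
  -- Specification meets finitely many of these closed conditions at a time; compactness meets all
  -- of them.
  have hne : (Set.univ ∩ ⋂ g, A g).Nonempty := by
    refine isCompact_univ.inter_iInter_nonempty A hA fun t => ?_
    obtain ⟨z, hz⟩ := h (ULift.{u} Bool) (fun b => if b.down then F else t \ (Λ * F)) (by
      rintro ⟨j⟩ ⟨k⟩ hjk a ha b hb hab
      cases j <;> cases k
      · exact hjk rfl
      · simp only [Bool.false_eq_true, if_false, if_true, Finset.mem_sdiff] at ha hb
        exact ha.2 (Finset.mem_mul.2 ⟨_, hab, b, hb, by simp⟩)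
      · simp only [Bool.false_eq_true, if_false, if_true, Finset.mem_sdiff] at ha hb
        exact hb.2 (Finset.mem_mul.2 ⟨_, hinv _ hab, a, ha, by simp⟩)
      · exact hjk rfl) (fun b => if b.down then x else y)
    refine ⟨z, trivial, Set.mem_iInter₂.2 fun g hg => ⟨fun hgF => ?_, fun hgF => ?_⟩⟩
    · simpa using hz ⟨true⟩ g (by simpa using hgF)
    · simpa using hz ⟨false⟩ g (by simpa using ⟨hg, by simpa using hgF⟩)
  obtain ⟨z, -, hz⟩ := hne
  rw [Set.mem_iInter] at hz
  exact ⟨z, fun g hg => (hz g).1 hg, fun g hg => (hz g).2 hg⟩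

/-! ### Expansiveness and pre-injectivity -/

/-- The closed conditions over all g cut out only the diagonal, which lies in `interior V`; by
compactness finitely many of them suffice. -/
theorem exists_finset_close_of_expansive {U₀ V : Set (X × X)} (hcl : IsClosed U₀)
    (hexp : ∀ x y : X, (∀ g : G, (g • x, g • y) ∈ U₀) → x = y) (hV : V ∈ 𝓤 X) :
    ∃ K : Finset G, ∀ x y : X, (∀ g ∈ K, (g • x, g • y) ∈ U₀) → (x, y) ∈ V := by
  by_contra! hK
  have hA : ∀ g : G, IsClosed {q : X × X | (g • q.1, g • q.2) ∈ U₀} := fun g =>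
    hcl.preimage (((continuous_const_smul g).comp continuous_fst).prodMk
      ((continuous_const_smul g).comp continuous_snd))
  have hcomp : IsCompact (interior V)ᶜ := isOpen_interior.isClosed_compl.isCompact
  obtain ⟨q, hq, hqA⟩ := hcomp.inter_iInter_nonempty _ hA fun K => by
    obtain ⟨x, y, hxy, hn⟩ := hK K
    exact ⟨(x, y), fun hi => hn (interior_subset hi), Set.mem_iInter₂.2 hxy⟩
  rw [Set.mem_iInter] at hqA
  have hqq : q.1 = q.2 := hexp _ _ hqA
  refine hq (mem_interior_iff_mem_nhds.2 ?_)
  obtain ⟨a, b⟩ := q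
  obtain rfl : a = b := hqq
  exact nhds_le_uniformity a hV

theorem homoclinic_of_close {U₀ : Set (X × X)} (hcl : IsClosed U₀)
    (hexp : ∀ x y : X, (∀ g : G, (g • x, g • y) ∈ U₀) → x = y) {x y : X} (F : Finset G)
    (h : ∀ g ∉ F, (g • x, g • y) ∈ U₀) : Homoclinic G x y := by
  classical
  intro V hV
  obtain ⟨K, hK⟩ := exists_finset_close_of_expansive (G := G) hcl hexp hV
  refine ⟨K⁻¹ * F, fun g hg => hK _ _ fun k hk => ?_⟩
  rw [smul_smul, smul_smul]
  refine h _ fun hkg => hg ?_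
  exact Finset.mem_mul.2 ⟨k⁻¹, by simpa using hk, k * g, hkg, by simp⟩

/-- A pre-injective endomorphism loses at most boundary many separated points. -/
theorem IsPreInjective.exists_isSep_image [DecidableEq G] {f : X → X} (hf : IsEndomorphism G f)
    (hpre : IsPreInjective G f) {U₀ W U U' V : Set (X × X)} {Λ F : Finset G}
    (hcl : IsClosed U₀) (hexp : ∀ x y : X, (∀ g : G, (g • x, g • y) ∈ U₀) → x = y)
    (hUcl : IsClosed U) (hUsymm : ∀ x y, (x, y) ∈ U → (y, x) ∈ U)
    (hUV : ∀ a b c, (a, b) ∈ U → (b, c) ∈ U → (a, c) ∈ V)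
    (hVU₀ : V ⊆ U₀) (hVf : ∀ x y, (x, y) ∈ V → (f x, f y) ∈ U₀)
    (hUU' : ∀ a b c, (a, b) ∈ U → (b, c) ∈ U → (a, c) ∈ U')
    (hinv : ∀ g ∈ Λ, g⁻¹ ∈ Λ) (hspec : IsSpecWitness U Λ)
    (hWrefl : ∀ x, (x, x) ∈ W) (hWsymm : ∀ x y, (x, y) ∈ W → (y, x) ∈ W)
    (hWcomp : ∀ x y z, (x, y) ∈ W → (y, z) ∈ W → (x, z) ∈ U₀)
    {C : ℕ} (c : X → Fin C) (hc : ∀ x y, c x = c y → (x, y) ∈ U₀)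
    {S : Finset X} (hS : IsSep U' F S) :
    ∃ S' : Finset X, (∀ x ∈ S', x ∈ Set.range f) ∧ IsSep W F S' ∧
      S.card ≤ C ^ ((Λ * F) \ F).card * S'.card := by
  classical
  rcases S.eq_empty_or_nonempty with rfl | ⟨p, -⟩
  · exact ⟨∅, by simp, fun x hx => by simp at hx, by simp⟩
  choose z hzF hzp using fun x => hspec.exists_glue hUcl hinv F x p
  have hclose : ∀ x y, ∀ g ∉ Λ * F, (g • z x, g • z y) ∈ V := fun x y g hg =>
    hUV _ _ _ (hzp x g hg) (hUsymm _ _ (hzp y g hg))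
  have hzinj : ∀ x ∈ S, ∀ y ∈ S, z x = z y → x = y := fun x hx y hy hxy =>
    hS x hx y hy fun g hg => hUU' _ _ _ (hUsymm _ _ (hzF x g hg)) (hxy ▸ hzF y g hg)
  have hfz : ∀ x y, f (z x) = f (z y) → z x = z y := fun x y hxy =>
    hpre (z x) (homoclinic_of_close hcl hexp (Λ * F) fun g hg => hVU₀ (hclose x x g hg))
      (homoclinic_of_close hcl hexp (Λ * F) fun g hg => hVU₀ (hclose x y g hg)) hxy
  have hsep : IsSep U₀ (Λ * F) (S.image fun x => f (z x)) := by
    intro a ha b hb hab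
    obtain ⟨x, hx, rfl⟩ := Finset.mem_image.1 ha
    obtain ⟨y, hy, rfl⟩ := Finset.mem_image.1 hb
    -- Off ΛF the images are close anyway, by equivariance and the choice of V.
    refine hexp _ _ fun g => ?_
    by_cases hg : g ∈ Λ * F
    · exact hab g hg
    · rw [← hf.2, ← hf.2]
      exact hVf _ _ (hclose x y g hg)
  obtain ⟨S', hS', hsep', hcard⟩ := hsep.exists_restrict (F₁ := F) c hc hWrefl hWsymm hWcomp
  refine ⟨S', fun x hx => ?_, hsep', ?_⟩
  · obtain ⟨y, -, rfl⟩ := Finset.mem_image.1 (hS' hx)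
    exact ⟨_, rfl⟩
  · rwa [Finset.card_image_of_injOn fun x hx y hy hxy => hzinj x hx y hy (hfz x y hxy)] at hcard

end

/-! ### Inserting an avoided point -/

section

variable {G : Type u} {X : Type v} [Group G] [MulAction G X]

theorem IsSpecWitness.mono {U U' : Set (X × X)} {Λ : Finset G} (h : IsSpecWitness U Λ)
    (hU : U ⊆ U') : IsSpecWitness U' Λ := fun ι _ _ Ω hΩ p =>
  (h ι Ω hΩ p).imp fun _ hx i g hg => hU (hx i g hg)

/-- If `Y` stays away from `x₀`, inserting `x₀` at arbitrary subsets of `T` into points of `Y`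
multiplies the number of separated points by at least `(1 + C ^ (-|Λ|)) ^ |T|`. -/
theorem IsSpecWitness.exists_isSep_of_avoiding [DecidableEq G] {U W W' U₁ : Set (X × X)}
    {Λ F T : Finset G} (hspec : IsSpecWitness U Λ) (hinv : ∀ g ∈ Λ, g⁻¹ ∈ Λ)
    (hUrefl : ∀ x, (x, x) ∈ U) (hUsymm : ∀ x y, (x, y) ∈ U → (y, x) ∈ U)
    (hUW' : ∀ a b c d, (a, b) ∈ U → (b, c) ∈ U → (c, d) ∈ U → (a, d) ∈ W')
    (hUU₁ : ∀ a b c d, (a, b) ∈ U → (b, c) ∈ U → (c, d) ∈ U → (a, d) ∈ U₁)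
    (hWrefl : ∀ x, (x, x) ∈ W') (hWsymm : ∀ x y, (x, y) ∈ W' → (y, x) ∈ W')
    (hWcomp : ∀ x y z, (x, y) ∈ W' → (y, z) ∈ W' → (x, z) ∈ W)
    {C : ℕ} (c : X → Fin C) (hc : ∀ x y, c x = c y → (x, y) ∈ W) (hC : 0 < C)
    {x₀ : X} {S : Finset X} (hS : IsSep W F S)
    (havoid : ∀ y ∈ S, ∀ g : G, (x₀, g • y) ∉ U₁)
    (hTF : T ⊆ F) (hT : ∀ s ∈ T, ∀ t ∈ T, s * t⁻¹ ∈ Λ → s = t) :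
    ∃ S' : Finset X, IsSep U F S' ∧
      (1 + C ^ Λ.card) ^ T.card * S.card ≤ (C ^ Λ.card) ^ T.card * S'.card := by
  classical
  choose R hRS hRsep hRcard using fun I : Finset G =>
    hS.exists_restrict (F₁ := F \ (Λ * I)) c hc hWrefl hWsymm hWcomp
  have hz : ∀ (I : Finset G) (y : X), ∃ z : X, I ⊆ T →
      (∀ t ∈ I, (t • z, x₀) ∈ U) ∧ ∀ g ∈ F \ (Λ * I), (g • z, g • y) ∈ U := by
    intro I y
    by_cases hI : I ⊆ T
    · obtain ⟨z, hz⟩ := hspec (Option I)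
        (fun i => i.elim (F \ (Λ * I)) fun t => {(t : G)}) (by
          rintro (_ | j) (_ | k) hjk a ha b hb hab
          · exact hjk rfl
          · simp only [Option.elim, Finset.mem_sdiff, Finset.mem_singleton] at ha hb
            exact ha.2 (Finset.mem_mul.2 ⟨_, hab, b, hb ▸ k.2, by simp⟩)
          · simp only [Option.elim, Finset.mem_sdiff, Finset.mem_singleton] at ha hb
            exact hb.2 (Finset.mem_mul.2 ⟨_, hinv _ hab, a, ha ▸ j.2, by simp⟩)
          · simp only [Option.elim, Finset.mem_singleton] at ha hb
            subst ha hb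
            exact hjk (congrArg some (Subtype.ext (hT _ (hI j.2) _ (hI k.2) hab))))
        (fun i => i.elim y fun t => (t : G)⁻¹ • x₀)
      refine ⟨z, fun _ => ⟨fun t ht => ?_, fun g hg => hz none g hg⟩⟩
      simpa using hz (some ⟨t, ht⟩) t (by simp)
    · exact ⟨y, fun h => absurd h hI⟩
  choose z hz using hz
  -- The set I can be recovered: at t ∈ I \ J one orbit is near x₀ while the other follows y', which
  -- avoids x₀.
  have hsub : ∀ I ⊆ T, ∀ J ⊆ T, ∀ y, ∀ y' ∈ S, (∀ g ∈ F, (g • z I y, g • z J y') ∈ U) →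
      I ⊆ J := by
    intro I hI J hJ y y' hy' hclose t ht
    by_contra htJ
    have htF : t ∈ F := hTF (hI ht)
    refine havoid y' hy' t (hUU₁ _ _ _ _ (hUsymm _ _ ((hz I y hI).1 t ht)) (hclose t htF)
      ((hz J y' hJ).2 t (Finset.mem_sdiff.2 ⟨htF, fun hmem => htJ ?_⟩)))
    obtain ⟨l, hl, s, hs, rfl⟩ := Finset.mem_mul.1 hmem
    rw [hT _ (hI ht) s (hJ hs) (by simpa using hl)]
    exact hs
  have hkey : ∀ q ∈ T.powerset.sigma R, ∀ q' ∈ T.powerset.sigma R,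
      (∀ g ∈ F, (g • z q.1 q.2, g • z q'.1 q'.2) ∈ U) → q = q' := by
    rintro ⟨I, y⟩ hq ⟨J, y'⟩ hq' hclose
    simp only [Finset.mem_sigma, Finset.mem_powerset] at hq hq' hclose
    obtain rfl : I = J := (hsub I hq.1 J hq'.1 y y' (hRS _ hq'.2) hclose).antisymm
      (hsub J hq'.1 I hq.1 y' y (hRS _ hq.2) fun g hg => hUsymm _ _ (hclose g hg))
    obtain rfl : y = y' := hRsep I y hq.2 y' hq'.2 fun g hg =>
      hUW' _ _ _ _ (hUsymm _ _ ((hz I y hq.1).2 g hg)) (hclose g (Finset.mem_sdiff.1 hg).1)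
        ((hz I y' hq.1).2 g hg)
    rfl
  refine ⟨(T.powerset.sigma R).image fun q => z q.1 q.2, ?_, ?_⟩
  · intro a ha b hb hab
    obtain ⟨q, hq, rfl⟩ := Finset.mem_image.1 ha
    obtain ⟨q', hq', rfl⟩ := Finset.mem_image.1 hb
    rw [hkey q hq q' hq' hab]
  -- The binomial theorem expands the power as a sum over I ⊆ T, to be compared term by term with
  -- the sizes of `R I`.
  rw [Finset.card_image_of_injOn, Finset.card_sigma, Finset.mul_sum,
    ← Finset.sum_pow_mul_eq_add_pow, Finset.sum_mul]
  · refine Finset.sum_le_sum fun I hI => ?_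
    have hIT := Finset.card_le_card (Finset.mem_powerset.1 hI)
    have hexp : (F \ (F \ (Λ * I))).card ≤ Λ.card * I.card := by
      rw [sdiff_sdiff_right_self, Finset.inf_eq_inter]
      exact (Finset.card_le_card Finset.inter_subset_right).trans Finset.card_mul_le
    calc 1 ^ I.card * (C ^ Λ.card) ^ (T.card - I.card) * S.card
        ≤ (C ^ Λ.card) ^ (T.card - I.card) * ((C ^ Λ.card) ^ I.card * (R I).card) := by
          rw [one_pow, one_mul]
          refine Nat.mul_le_mul_left _ ((hRcard I).trans (Nat.mul_le_mul_right _ ?_))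
          rw [← pow_mul]
          exact Nat.pow_le_pow_right hC hexp
      _ = (C ^ Λ.card) ^ T.card * (R I).card := by
          rw [← mul_assoc, ← pow_add, Nat.sub_add_cancel hIT]
  · intro q hq q' hq' hqq'
    have hqq : z q.1 q.2 = z q'.1 q'.2 := hqq'
    exact hkey q hq q' hq' fun g _ => hqq ▸ hUrefl _

/-! ### Følner sets and numerical estimates -/

theorem IsAmenable.exists_folner [DecidableEq G] (hG : IsAmenable G) (Λ : Finset G) (n : ℕ) :
    ∃ F : Finset G, n * ((Λ * F) \ F).card < F.card := by
  obtain ⟨J, _, _, _, F, hne, hF⟩ := hG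
  have hcard : ∀ (g : G) (j : J),
      ((g • (F j : Set G)) \ (F j : Set G)).ncard = ((g • F j) \ F j).card := fun g j => by
    rw [← Finset.coe_smul_finset, ← Finset.coe_sdiff, Set.ncard_coe_finset]
  have hsum : Tendsto (fun j => ∑ g ∈ Λ, (((g • F j) \ F j).card : ℝ) / ((F j).card : ℝ))
      atTop (𝓝 0) := by
    simpa [hcard] using tendsto_finsetSum Λ fun g _ => hF g
  obtain ⟨j, hj⟩ := (hsum.eventually_lt_const
    (show (0 : ℝ) < 1 / (n + 1) by positivity)).exists
  refine ⟨F j, ?_⟩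
  have hpos : (0 : ℝ) < (F j).card := by exact_mod_cast (hne j).card_pos
  have hle : ((Λ * F j) \ F j).card ≤ ∑ g ∈ Λ, ((g • F j) \ F j).card := by
    refine (Finset.card_le_card fun x hx => ?_).trans Finset.card_biUnion_le
    obtain ⟨hx, hxF⟩ := Finset.mem_sdiff.1 hx
    obtain ⟨g, hg, y, hy, rfl⟩ := Finset.mem_mul.1 hx
    exact Finset.mem_biUnion.2
      ⟨g, hg, Finset.mem_sdiff.2 ⟨Finset.smul_mem_smul_finset hy, hxF⟩⟩
  rw [← Finset.sum_div, div_lt_div_iff₀ hpos (by positivity), one_mul] at hj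
  have hle' : (((Λ * F j) \ F j).card : ℝ) ≤ ∑ g ∈ Λ, (((g • F j) \ F j).card : ℝ) := by
    exact_mod_cast hle
  have hnn : (0 : ℝ) ≤ (((Λ * F j) \ F j).card : ℝ) := by positivity
  have : (n : ℝ) * ((Λ * F j) \ F j).card < (F j).card := by nlinarith
  exact_mod_cast this

theorem exists_pow_mul_lt (M C : ℕ) (hM : 0 < M) : ∃ k, M ^ k * C < (1 + M) ^ k := by
  have hM' : (0 : ℝ) < M := by exact_mod_cast hM
  obtain ⟨k, hk⟩ := pow_unbounded_of_one_lt (C : ℝ)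
    (show (1 : ℝ) < (1 + M) / M by rw [lt_div_iff₀ hM']; linarith)
  refine ⟨k, ?_⟩
  rw [div_pow, lt_div_iff₀ (by positivity)] at hk
  have : (M : ℝ) ^ k * C < (1 + M) ^ k := by linarith
  exact_mod_cast this

/-- Each of the b factors C is paid for by k of the t factors; at least one factor is left over and
gives strictness. -/
theorem pow_mul_pow_lt {M C k b t : ℕ} (hM : 0 < M) (hk : M ^ k * C < (1 + M) ^ k)
    (hb : k * b < t) : M ^ t * C ^ b < (1 + M) ^ t := by
  obtain ⟨d, rfl⟩ := Nat.exists_eq_add_of_lt hb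
  have h₁ : M ^ (k * b) * C ^ b ≤ (1 + M) ^ (k * b) := by
    rw [pow_mul, pow_mul, ← mul_pow]
    exact Nat.pow_le_pow_left hk.le b
  have h₂ : M ^ (d + 1) < (1 + M) ^ (d + 1) := Nat.pow_lt_pow_left (by omega) (by omega)
  calc M ^ (k * b + d + 1) * C ^ b = M ^ (k * b) * C ^ b * M ^ (d + 1) := by ring
    _ ≤ (1 + M) ^ (k * b) * M ^ (d + 1) := Nat.mul_le_mul_right _ h₁
    _ < (1 + M) ^ (k * b) * (1 + M) ^ (d + 1) := Nat.mul_lt_mul_of_pos_left h₂ (by positivity)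
    _ = (1 + M) ^ (k * b + d + 1) := by ring

end

/-! ### The contradiction -/

theorem hasMyhillProperty {G : Type u} {X : Type v} [Group G] [UniformSpace X] [CompactSpace X]
    [T2Space X] [MulAction G X] [ContinuousConstSMul G X] (hG : IsAmenable G)
    (hexp : IsExpansive G X) (hwsp : HasWeakSpecification G X) : HasMyhillProperty G X := by
  classical
  intro f hf hpre
  by_contra hsurj
  obtain ⟨x₀, hx₀⟩ : ∃ x₀, x₀ ∉ Set.range f := by
    simpa [Function.Surjective] using hsurj
  have hcont : Continuous f := hf.1
  have hopen : (Set.range f)ᶜ ∈ 𝓝 x₀ :=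
    (isCompact_range hcont).isClosed.isOpen_compl.mem_nhds hx₀
  obtain ⟨U₁, hU₁, hU₁f⟩ := UniformSpace.mem_nhds_iff.1 hopen
  have havoid : ∀ y ∈ Set.range f, ∀ g : G, (x₀, g • y) ∉ U₁ := by
    rintro _ ⟨x, rfl⟩ g hg
    exact hU₁f hg ⟨g • x, hf.2 g x⟩
  obtain ⟨E, hE, hexpE⟩ := hexp
  obtain ⟨U₀, hU₀, hU₀E, hU₀cl⟩ : ∃ U₀ ∈ 𝓤 X, U₀ ⊆ E ∧ IsClosed U₀ := by
    obtain ⟨U₀, h₁, h₂, h₃⟩ := mem_uniformity_isClosed hE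
    exact ⟨U₀, h₁, h₃, h₂⟩
  have hexp₀ : ∀ x y : X, (∀ g : G, (g • x, g • y) ∈ U₀) → x = y := fun x y h =>
    hexpE x y fun g => hU₀E (h g)
  obtain ⟨W, hW, -, hWsymm, hWcomp⟩ := exists_entourage hU₀
  obtain ⟨W', hW', -, hW'symm, hW'comp⟩ := exists_entourage hW
  have hV : U₀ ∩ {q : X × X | (f q.1, f q.2) ∈ U₀} ∈ 𝓤 X :=
    inter_mem hU₀ (CompactSpace.uniformContinuous_of_continuous hcont hU₀)
  -- U serves both the image step and the insertion step; U' below is one notch finer, for gluing.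
  obtain ⟨U, hU, -, hUsymm, hUcomp⟩ :=
    exists_entourage (inter_mem hV (inter_mem hW' hU₁))
  obtain ⟨U', hU', hU'cl, hU'symm, hU'comp⟩ := exists_entourage hU
  have hrefl : ∀ {V : Set (X × X)}, V ∈ 𝓤 X → ∀ x, (x, x) ∈ V := fun hV x =>
    refl_mem_uniformity hV
  have hU'U : U' ⊆ U := fun q hq => hU'comp q.1 q.2 q.2 q.2 hq (hrefl hU' _) (hrefl hU' _)
  have hW₀ : W ⊆ U₀ := fun q hq => hWcomp q.1 q.2 q.2 q.2 hq (hrefl hW _) (hrefl hW _)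
  obtain ⟨Λ, hone, hinv, hspec⟩ := hwsp.exists_witness hU'
  obtain ⟨C, c, hc⟩ := exists_code hW
  obtain ⟨CU, cU, hcU⟩ := exists_code hU
  have hC : 0 < C := (c x₀).pos
  have hM : 0 < C ^ Λ.card := by positivity
  obtain ⟨k, hk⟩ := exists_pow_mul_lt (C ^ Λ.card) C hM
  -- The factor |Λ| pays for passing from F to T.
  obtain ⟨F, hF⟩ := hG.exists_folner Λ (Λ.card * k)
  obtain ⟨T, hTF, hT, hTcard⟩ := exists_separated_subset Λ F hone hinv
  have hbt : k * ((Λ * F) \ F).card < T.card := by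
    refine lt_of_mul_lt_mul_left (a := Λ.card) ?_ (Nat.zero_le _)
    rw [← mul_assoc]
    exact hF.trans_le hTcard
  let N : Set ℕ := {n | ∃ S : Finset X, IsSep U F S ∧ S.card = n}
  have hNne : N.Nonempty := ⟨1, {x₀}, fun x hx y hy _ => by
    rw [Finset.mem_singleton.1 hx, Finset.mem_singleton.1 hy], by simp⟩
  have hNbdd : BddAbove N := by
    refine ⟨CU ^ F.card, ?_⟩
    rintro _ ⟨S, hS, rfl⟩
    exact hS.card_le cU hcU
  obtain ⟨S, hS, hScard⟩ := Nat.sSup_mem hNne hNbdd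
  have hSmax : ∀ S' : Finset X, IsSep U F S' → S'.card ≤ S.card := fun S' hS' =>
    hScard ▸ le_csSup hNbdd ⟨S', hS', rfl⟩
  have hSpos : 0 < S.card :=
    (hSmax {x₀} fun x hx y hy _ => by
      rw [Finset.mem_singleton.1 hx, Finset.mem_singleton.1 hy]).trans_lt' (by simp)
  have hU'two : ∀ a b c, (a, b) ∈ U' → (b, c) ∈ U' → (a, c) ∈ U := fun a b c hab hbc =>
    hU'comp a b c c hab hbc (hrefl hU' _)
  have hUV : ∀ q ∈ U, q ∈ U₀ ∩ {q : X × X | (f q.1, f q.2) ∈ U₀} := fun q hq =>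
    (hUcomp q.1 q.2 q.2 q.2 hq (hrefl hU _) (hrefl hU _)).1
  obtain ⟨S₁, hS₁f, hS₁, hS₁card⟩ := hpre.exists_isSep_image hf hU₀cl hexp₀ hU'cl hU'symm
    hU'two (fun q hq => (hUV q hq).1) (fun x y hxy => (hUV (x, y) hxy).2) hU'two hinv hspec
    (hrefl hW) hWsymm (fun x y z hxy hyz => hWcomp x y z z hxy hyz (hrefl hW _)) c
    (fun x y hxy => hW₀ (hc x y hxy)) hS
  obtain ⟨S₂, hS₂, hS₂card⟩ := (hspec.mono hU'U).exists_isSep_of_avoiding hinv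
    (hrefl hU) hUsymm
    (fun a b c d h₁ h₂ h₃ => (hUcomp a b c d h₁ h₂ h₃).2.1)
    (fun a b c d h₁ h₂ h₃ => (hUcomp a b c d h₁ h₂ h₃).2.2)
    (hrefl hW') hW'symm (fun x y z hxy hyz => hW'comp x y z z hxy hyz (hrefl hW' _)) c hc hC
    hS₁ (fun y hy => havoid y (hS₁f y hy)) hTF hT
  have hS₁pos : 0 < S₁.card := Nat.pos_of_mul_pos_left (hSpos.trans_le hS₁card)
  have hlt := Nat.mul_lt_mul_of_pos_right (pow_mul_pow_lt hM hk hbt) hS₁pos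
  refine absurd (hlt.trans_le (hS₂card.trans ?_)) (lt_irrefl _)
  rw [mul_assoc]
  exact Nat.mul_le_mul_left _ ((hSmax S₂ hS₂).trans hS₁card)

theorem HasMyhillProperty.isSurjunctive {G : Type u} {X : Type v} [Group G] [UniformSpace X]
    [MulAction G X] (h : HasMyhillProperty G X) : IsSurjunctive G X :=
  fun f hf hinj => h f hf fun _ => hinj.injOn

end UniformDynamics

/-- `X` is a compact Hausdorff space with its unique compatible uniform structure; each `g : G` acts
by a continuous map. -/
theorem theorem1p1 (G : Type*) [Group G] (X : Type*) [UniformSpace X] [CompactSpace X] [T2Space X]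
    [MulAction G X] [ContinuousConstSMul G X]
    (hG : UniformDynamics.IsAmenable G)
    (hexp : UniformDynamics.IsExpansive G X)
    (hwsp : UniformDynamics.HasWeakSpecification G X) :
    UniformDynamics.HasMyhillProperty G X ∧ UniformDynamics.IsSurjunctive G X := by
  have h := UniformDynamics.hasMyhillProperty hG hexp hwsp
  exact ⟨h, h.isSurjunctive⟩
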